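/- Let $n,p\ge 1$, $X\in\mathbb R^{n\times p}$ a fixed design with columns $\|X_j\|_2=\sqrt n$, $\beta^*\in\mathbb R^p$, and $y=X\beta^*+\xi$, where $\xi_1,\dots,\xi_n$ are i.i.d. with mean zero and $\mathrm{pr}(|\xi_i|>u)\le 2\exp\{-u^2/(2\sigma^2)\}$ for all $u\ge 0$, $\sigma>0$. Let $S^*=\{i:\beta^*_i\ne 0\}$, $s^*=|S^*|$. The matrix $X$ satisfies $\mathrm{RIP}(m,\delta)$, $0<\delta<1$, if $(1-\delta)n\|u\|_2^2\le\|Xu\|_2^2\le(1+\delta)n\|u\|_2^2$ for all $u\in\mathbb R^p$ with at most $m$ non-zero entries. Hard thresholding pursuit (HTP) with model size $s$, started at $\beta^0$, iterates $$\tilde\beta^{t+1}=\mathcal T_s\bigl(\beta^t+X^\top(y-X\beta^t)/n\bigr),\quad S^{t+1}=\mathrm{supp}(\tilde\beta^{t+1}),\quad \beta^{t+1}\in\arg\min\{\|y-X\beta\|_2:\ \mathrm{supp}(\beta)\subseteq S^{t+1}\},$$ where $\mathcal T_s$ keeps the $s$ entries that are largest in absolute value (all entries if $s>p$; ties broken arbitrarily)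 and sets the others to zero. For $C_1>0$ split $S^*$ into the strong signals $S_1^*=\{i\in S^*:|\beta_i^*|\ge C_1\sigma(\log p/n)^{1/2}\}$ and the weak signals $S_2^*=S^*\setminus S_1^*$. No beta-min condition is assumed. There is an absolute constant $c_1>0$ such that for all $C_1\ge c_1$ and $C_0>0$ there are constants $C_2,C_3,C_4,C_5>0$, depending only on $C_0$ and $C_1$, with the following property. Let $s=|S_1^*|+\tau$ with an integer $0\le\tau\le|S_1^*|/\log(p/|S_1^*|)$ (read as $\tau=0$ if $|S_1^*|\in\{0,p\}$), let $X$ satisfy $\mathrm{RIP}(3\max(s,s^*),\delta)$ with $\delta<0.005$, and let the (possibly data-dependent) initial estimator satisfy, almost surely, $\|\beta^0\|_0\le s$ and $$\|\beta^0-\beta^*\|_2^2\le C_0^2\Bigl(\sigma^2\frac{|S_1^*|\log p}{n}+\|\beta^*_{S_2^*}\|_2^2\Bigr).$$ Then for every integer $t\ge 0$ with $t\ge\log(C_2^2\log p)$ (where $\log 0$ is read as $0$ if $p=1$), $$\mathrm{pr}\Bigl\{\|\beta^t-\beta^*\|_2^2\ge C_3\Bigl(\sigma^2\frac{|S_1^*|}{n}+\|\beta^*_{S_2^*}\|_2^2\Bigr)\Bigr\}\le\exp(-C_4|S_1^*|)+\Bigl(\frac{|S_1^*|}{p}\Bigr)^{C_5}.$$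 -/

import Mathlib

open MeasureTheory ProbabilityTheory

noncomputable section

namespace HTP

/-- Squared Euclidean norm of a vector. -/
def sqNorm {m : ℕ} (v : Fin m → ℝ) : ℝ := ∑ i, v i ^ 2

/-- Support of a vector; its cardinality is `‖v‖₀`. -/
def supp {m : ℕ} (v : Fin m → ℝ) : Finset (Fin m) := Finset.univ.filter fun i => v i ≠ 0

/-- Restricted isometry property of order `m` with constant `δ`. A vector indexed by a set `S`
with `|S| ≤ m` is the same thing as a vector of `ℝ^p` with support in `S`. -/
def RIP {n p : ℕ} (X : Matrix (Fin n) (Fin p) ℝ) (m : ℕ) (δ : ℝ) : Prop :=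
  0 < δ ∧ δ < 1 ∧ ∀ S : Finset (Fin p), S.card ≤ m → ∀ u : Fin p → ℝ, supp u ⊆ S →
    (1 - δ) * (n * sqNorm u) ≤ sqNorm (X.mulVec u) ∧
      sqNorm (X.mulVec u) ≤ (1 + δ) * (n * sqNorm u)

/-- `w` is a value of the hard thresholding operator of level `s` at `v`: it keeps `s` entries of
`v` that are largest in absolute value (all entries if `s > m`) and sets the others to zero.
Ties may be broken in any way. -/
def IsHardThreshold {m : ℕ} (s : ℕ) (v w : Fin m → ℝ) : Prop :=
  ∃ T : Finset (Fin m), T.card = min s m ∧ (∀ i ∈ T, ∀ j ∉ T, |v j| ≤ |v i|) ∧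
    ∀ i, w i = if i ∈ T then v i else 0

/-- The gradient step `b + Xᵀ(y - Xb)/n`. -/
def gradStep {n p : ℕ} (X : Matrix (Fin n) (Fin p) ℝ) (y : Fin n → ℝ) (b : Fin p → ℝ) :
    Fin p → ℝ :=
  fun i => b i + X.transpose.mulVec (y - X.mulVec b) i / n

/-- One iteration of hard thresholding pursuit with model size `s`: from `b` to `b'`.
`w` is the thresholded gradient step, and `b'` is a least-squares fit on the support of `w`. -/
def IsStep {n p : ℕ} (X : Matrix (Fin n) (Fin p) ℝ) (y : Fin n → ℝ) (s : ℕ)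
    (b b' : Fin p → ℝ) : Prop :=
  ∃ w : Fin p → ℝ, IsHardThreshold s (gradStep X y b) w ∧ supp b' ⊆ supp w ∧
    ∀ u : Fin p → ℝ, supp u ⊆ supp w →
      sqNorm (y - X.mulVec b') ≤ sqNorm (y - X.mulVec u)

/-- The strong signals: coordinates in the support with absolute value at least `c`. -/
def strong {p : ℕ} (c : ℝ) (β : Fin p → ℝ) : Finset (Fin p) := (supp β).filter fun i => c ≤ |β i|

/-- The weak signals: coordinates in the support with absolute value below `c`. -/
def weak {p : ℕ} (c : ℝ) (β : Fin p → ℝ) : Finset (Fin p) := (supp β).filter fun i => |β i| < c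

/-- The errors `ξ i` are i.i.d. with mean zero and sub-Gaussian tails with parameter `σ`. -/
structure IsSubGaussianNoise {Ω : Type*} [MeasurableSpace Ω] (μ : Measure Ω) {n : ℕ}
    (ξ : Fin n → Ω → ℝ) (σ : ℝ) : Prop where
  measurable : ∀ i, Measurable (ξ i)
  indep : iIndepFun ξ μ
  identDistrib : ∀ i j, IdentDistrib (ξ i) (ξ j) μ μ
  integrable : ∀ i, Integrable (ξ i) μ
  mean_zero : ∀ i, ∫ ω, ξ i ω ∂μ = 0
  tail : ∀ i, ∀ t : ℝ, 0 ≤ t → μ.real {ω | t < |ξ i ω|} ≤ 2 * Real.exp (-(t ^ 2 / (2 * σ ^ 2)))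

end HTP

end

namespace HTP

/-! ### Sub-Gaussian moment generating functions from tail bounds -/

/-! The argument separates an event depending on the noise alone from a deterministic contraction on
that event. The event is uniform over all supports in play, so data-dependent starts and iterates
cost nothing. It asks two things of `Xᵀξ/n`: every coordinate is at most `L = 23σ√(log p/n)`, and
the energy on `S₁ ∪ A` is below `640σ²|S₁|/n` whenever `|A| ≤ τ`.

On this event a step divides the squared error by 3, up to a floor of order `σ²|S₁|/n` plus the weak
energy. A strong signal is at least `4L`, so noise alone cannot displace it: the energy of missed
strong signals is controlled by the `I - XᵀX/n` error and the weak signals (`sum_sq_missed_le`). The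
false positives number at most `τ` plus the misses. The first `τ` fall under the uniform energy
bound, and each further one carries noise at most a quarter of a missed signal (`sum_sq_noise_le`).
Hence the floor has no factor `log p`. The normal equations turn these bounds into
`IsStep.sqNorm_sub_le`, and `log log p` steps remove the `log p` in the initial error.

The event is likely because Gaussian decoupling gives `‖(Xᵀξ)_A‖²` an exponential moment of at most
`2 ^ |A|`, and the condition on `τ` keeps the union over `A` at cost `exp (3|S₁|)`
(`sum_two_pow_card_le`). -/

lemma exp_le_add_exp_sq (x : ℝ) : Real.exp x ≤ x + Real.exp (x ^ 2) := by
  have h2 : x ^ 2 + 1 ≤ Real.exp (x ^ 2) := Real.add_one_le_exp _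
  rcases le_total |x| 1 with h | h
  · have h1 := (abs_le.1 (Real.abs_exp_sub_one_sub_id_le h)).2
    linarith
  · rcases le_total 0 x with h0 | h0
    · rw [abs_of_nonneg h0] at h
      have : Real.exp x ≤ Real.exp (x ^ 2) := Real.exp_le_exp.2 (by nlinarith)
      linarith
    · rw [abs_of_nonpos h0] at h
      have : Real.exp x ≤ 1 := Real.exp_le_one_iff.2 h0
      nlinarith

/-- Convexity of the exponential along the chord over `[0, v]`. -/
lemma exp_mul_le_chord {θ v : ℝ} (h0 : 0 ≤ θ) (h1 : θ ≤ 1) :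
    Real.exp (θ * v) ≤ 1 + θ * (Real.exp v - 1) := by
  have h := convexOn_exp.2 (Set.mem_univ (0 : ℝ)) (Set.mem_univ v) (sub_nonneg.2 h1) h0
    (by ring)
  simp only [smul_eq_mul, mul_zero, zero_add, Real.exp_zero, mul_one] at h
  linarith

section Tail

variable {Ω : Type*} [MeasurableSpace Ω] {μ : Measure Ω} [IsProbabilityMeasure μ]
  {f : Ω → ℝ} {σ : ℝ}

/-- Layer-cake formula: the level `t` of `f²/(4σ²)` has tail at most `2 exp(-2t)`, which is
integrated against `exp t`. -/
lemma lintegral_exp_sq_sub_one_le (hσ : 0 < σ) (hf : Measurable f)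
    (htail : ∀ t : ℝ, 0 ≤ t →
      μ.real {ω | t < |f ω|} ≤ 2 * Real.exp (-(t ^ 2 / (2 * σ ^ 2)))) :
    ∫⁻ ω, ENNReal.ofReal (Real.exp (f ω ^ 2 / (4 * σ ^ 2)) - 1) ∂μ ≤ ENNReal.ofReal 2 := by
  have key := lintegral_comp_eq_lintegral_meas_lt_mul μ (f := fun ω => f ω ^ 2 / (4 * σ ^ 2))
    (g := Real.exp) (ae_of_all _ fun ω => by positivity) (by fun_prop)
    (fun t _ => Real.continuous_exp.intervalIntegrable 0 t)
    (ae_of_all _ fun t => (Real.exp_pos t).le)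
  simp only [integral_exp, Real.exp_zero] at key
  rw [key]
  calc ∫⁻ t in Set.Ioi (0 : ℝ), μ {ω | t < f ω ^ 2 / (4 * σ ^ 2)} * ENNReal.ofReal (Real.exp t)
      ≤ ∫⁻ t in Set.Ioi (0 : ℝ), ENNReal.ofReal (2 * Real.exp (-t)) := by
        refine setLIntegral_mono (by fun_prop) fun t ht => ?_
        have ht0 : (0 : ℝ) < t := ht
        have hsub : {ω | t < f ω ^ 2 / (4 * σ ^ 2)} ⊆ {ω | 2 * σ * Real.sqrt t < |f ω|} := by
          intro ω hω
          have h : t < f ω ^ 2 / (4 * σ ^ 2) := hω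
          rw [lt_div_iff₀ (by positivity)] at h
          refine lt_of_pow_lt_pow_left₀ 2 (abs_nonneg (f ω)) ?_
          rw [mul_pow, mul_pow, Real.sq_sqrt ht0.le, sq_abs]
          linarith
        have h1 := (measureReal_mono (μ := μ) hsub).trans
          (htail (2 * σ * Real.sqrt t) (by positivity))
        have h2 : (2 * σ * Real.sqrt t) ^ 2 / (2 * σ ^ 2) = 2 * t := by
          rw [mul_pow, mul_pow, Real.sq_sqrt ht0.le]
          field_simp
        rw [h2] at h1
        rw [← ofReal_measureReal, ← ENNReal.ofReal_mul measureReal_nonneg]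
        refine ENNReal.ofReal_le_ofReal ?_
        calc _ ≤ 2 * Real.exp (-(2 * t)) * Real.exp t := by gcongr
          _ = 2 * Real.exp (-t) := by rw [mul_assoc, ← Real.exp_add]; ring_nf
    _ = ENNReal.ofReal 2 := by
        rw [← ofReal_integral_eq_lintegral_ofReal
          ((integrableOn_exp_neg_Ioi 0).const_mul 2) (ae_of_all _ fun t => by positivity),
          integral_const_mul, integral_exp_neg_Ioi_zero, mul_one]

/-- A centered random variable with sub-Gaussian tails has a sub-Gaussian moment generating
function. -/
lemma hasSubgaussianMGF_of_tail (hσ : 0 < σ) (hf : Measurable f) (hint : Integrable f μ)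
    (hmean : ∫ ω, f ω ∂μ = 0)
    (htail : ∀ t : ℝ, 0 ≤ t →
      μ.real {ω | t < |f ω|} ≤ 2 * Real.exp (-(t ^ 2 / (2 * σ ^ 2)))) :
    HasSubgaussianMGF f (16 * σ ^ 2).toNNReal μ := by
  set h : Ω → ℝ := fun ω => Real.exp (f ω ^ 2 / (4 * σ ^ 2)) - 1 with hdef
  have hh0 : ∀ ω, 0 ≤ h ω := fun ω => by
    have : (0 : ℝ) ≤ f ω ^ 2 / (4 * σ ^ 2) := by positivity
    simpa [hdef] using this
  have hle := lintegral_exp_sq_sub_one_le hσ hf htail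
  have hhm : Measurable h := by fun_prop
  have hhi : Integrable h μ := by
    refine ⟨hhm.aestronglyMeasurable, ?_⟩
    rw [hasFiniteIntegral_iff_ofReal (ae_of_all _ hh0)]
    exact hle.trans_lt ENNReal.ofReal_lt_top
  have hI : ∫ ω, h ω ∂μ ≤ 2 := by
    rw [integral_eq_lintegral_of_nonneg_ae (ae_of_all _ hh0) hhm.aestronglyMeasurable]
    exact ENNReal.toReal_le_of_le_ofReal (by norm_num) hle
  have hσ2 : (0 : ℝ) < σ ^ 2 := by positivity
  have hamgm : ∀ t ω, Real.exp (t * f ω) ≤ Real.exp (t ^ 2 * σ ^ 2) * (h ω + 1) := by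
    intro t ω
    simp only [hdef, sub_add_cancel, ← Real.exp_add]
    refine Real.exp_le_exp.2 ?_
    have : t ^ 2 * σ ^ 2 + f ω ^ 2 / (4 * σ ^ 2) - t * f ω
        = (t * σ - f ω / (2 * σ)) ^ 2 := by field_simp; ring
    nlinarith [sq_nonneg (t * σ - f ω / (2 * σ))]
  have hexpi : ∀ t, Integrable (fun ω => Real.exp (t * f ω)) μ := fun t => by
    refine Integrable.mono' ((hhi.add (integrable_const (1 : ℝ))).const_mul
      (Real.exp (t ^ 2 * σ ^ 2))) (by fun_prop) (ae_of_all _ fun ω => ?_)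
    rw [Real.norm_of_nonneg (Real.exp_pos _).le]
    exact hamgm t ω
  refine ⟨hexpi, fun t => ?_⟩
  have hc : ((16 * σ ^ 2).toNNReal : ℝ) * t ^ 2 / 2 = 8 * (t ^ 2 * σ ^ 2) := by
    rw [Real.coe_toNNReal _ (by positivity)]; ring
  rw [hc, mgf]
  set q := t ^ 2 * σ ^ 2 with hq
  have hq0 : 0 ≤ q := by positivity
  -- For small `q` the linear term of the exponential must cancel through the zero mean, giving `1 +
  -- 8q`. For `q ≥ 1/4` the crude AM-GM bound `3 exp q` suffices, as `3 ≤ exp (7q)`.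
  rcases le_total (4 * q) 1 with h1 | h1
  · have hb : ∀ ω, Real.exp (t * f ω) ≤ t * f ω + (1 + 4 * q * h ω) := fun ω => by
      have e1 := exp_le_add_exp_sq (t * f ω)
      have e2 := exp_mul_le_chord (v := f ω ^ 2 / (4 * σ ^ 2)) (by positivity : 0 ≤ 4 * q) h1
      have e3 : 4 * q * (f ω ^ 2 / (4 * σ ^ 2)) = (t * f ω) ^ 2 := by
        rw [hq]; field_simp
      rw [e3] at e2
      linarith
    have i1 : Integrable (fun ω => t * f ω) μ := hint.const_mul t
    have i2 : Integrable (fun ω => 1 + 4 * q * h ω) μ :=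
      (integrable_const (1 : ℝ)).add (hhi.const_mul (4 * q))
    calc ∫ ω, Real.exp (t * f ω) ∂μ ≤ ∫ ω, (t * f ω + (1 + 4 * q * h ω)) ∂μ :=
          integral_mono (hexpi t) (i1.add i2) hb
      _ = 1 + 4 * q * ∫ ω, h ω ∂μ := by
          rw [integral_add i1 i2, integral_add (integrable_const _) (hhi.const_mul _),
            integral_const_mul, integral_const_mul, hmean]
          simp
      _ ≤ 8 * q + 1 := by nlinarith
      _ ≤ Real.exp (8 * q) := Real.add_one_le_exp _
  · calc ∫ ω, Real.exp (t * f ω) ∂μ ≤ ∫ ω, Real.exp q * (h ω + 1) ∂μ :=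
          integral_mono (hexpi t) ((hhi.add (integrable_const (1 : ℝ))).const_mul _) (hamgm t)
      _ = Real.exp q * (∫ ω, h ω ∂μ + 1) := by
          rw [integral_const_mul, integral_add hhi (integrable_const _)]
          simp
      _ ≤ Real.exp q * Real.exp (7 * q) := by
          gcongr
          have e1 : (7 * q / 2) + 1 ≤ Real.exp (7 * q / 2) := Real.add_one_le_exp _
          have e2 : Real.exp (7 * q) = Real.exp (7 * q / 2) * Real.exp (7 * q / 2) := by
            rw [← Real.exp_add]; ring_nf
          nlinarith
      _ = Real.exp (8 * q) := by rw [← Real.exp_add]; ring_nf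

/-- Phrased with a lower integral so that Tonelli applies below without integrability conditions. -/
lemma IsSubGaussianNoise.lintegral_exp_linear_le {n : ℕ} {ξ : Fin n → Ω → ℝ}
    (hξ : IsSubGaussianNoise μ ξ σ) (hσ : 0 < σ) (a : Fin n → ℝ) :
    ∫⁻ ω, ENNReal.ofReal (Real.exp (∑ i, a i * ξ i ω)) ∂μ
      ≤ ENNReal.ofReal (Real.exp (8 * σ ^ 2 * sqNorm a)) := by
  have hi := fun i => (hasSubgaussianMGF_of_tail hσ (hξ.measurable i) (hξ.integrable i)
    (hξ.mean_zero i) (hξ.tail i)).const_mul (a i)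
  have hindep : iIndepFun (fun i ω => a i * ξ i ω) μ :=
    hξ.indep.comp (fun i x => a i * x) fun i => by fun_prop
  have hs := HasSubgaussianMGF.sum_of_iIndepFun hindep (s := Finset.univ) fun i _ => hi i
  have h1 := hs.integrable_exp_mul 1
  have h2 := hs.mgf_le 1
  simp only [mgf, one_mul] at h1 h2
  rw [← ofReal_integral_eq_lintegral_ofReal h1 (ae_of_all _ fun ω => (Real.exp_pos _).le)]
  refine ENNReal.ofReal_le_ofReal (h2.trans (Real.exp_le_exp.2 (le_of_eq ?_)))
  have hc : ((16 * σ ^ 2).toNNReal : ℝ) = 16 * σ ^ 2 := Real.coe_toNNReal _ (by positivity)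
  simp only [sqNorm, NNReal.coe_sum, Finset.mul_sum, Finset.sum_mul, Finset.sum_div]
  refine Finset.sum_congr rfl fun i _ => ?_
  change a i ^ 2 * ((16 * σ ^ 2).toNNReal : ℝ) * 1 ^ 2 / 2 = _
  rw [hc]
  ring

end Tail

/-! ### Gaussian decoupling of quadratic forms -/

lemma lintegral_exp_mul_gaussianReal (c : ℝ) :
    ∫⁻ g, ENNReal.ofReal (Real.exp (c * g)) ∂(gaussianReal 0 1)
      = ENNReal.ofReal (Real.exp (c ^ 2 / 2)) := by
  rw [← ofReal_integral_eq_lintegral_ofReal (integrable_exp_mul_gaussianReal c)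
    (ae_of_all _ fun ω => (Real.exp_pos _).le)]
  have := congrFun (mgf_fun_id_gaussianReal (μ := 0) (v := 1)) c
  simp only [mgf] at this
  rw [this]
  simp

lemma lintegral_exp_sq_div_four_gaussianReal_le :
    ∫⁻ g, ENNReal.ofReal (Real.exp (g ^ 2 / 4)) ∂(gaussianReal 0 1) ≤ 2 := by
  rw [gaussianReal_of_var_ne_zero 0 one_ne_zero,
    lintegral_withDensity_eq_lintegral_mul _ (measurable_gaussianPDF 0 1) (by fun_prop)]
  have h : ∀ x : ℝ, (gaussianPDF 0 1 * fun g => ENNReal.ofReal (Real.exp (g ^ 2 / 4))) x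
      = ENNReal.ofReal ((Real.sqrt (2 * Real.pi))⁻¹ * Real.exp (-(1 / 4) * x ^ 2)) := by
    intro x
    simp only [Pi.mul_apply, gaussianPDF, gaussianPDFReal]
    rw [← ENNReal.ofReal_mul (by positivity)]
    congr 1
    simp only [NNReal.coe_one, mul_one, sub_zero]
    rw [mul_assoc, ← Real.exp_add]
    ring_nf
  simp_rw [h]
  rw [← ofReal_integral_eq_lintegral_ofReal
    ((integrable_exp_neg_mul_sq (by norm_num)).const_mul _) (ae_of_all _ fun x => by positivity),
    integral_const_mul, integral_gaussian]
  rw [show (2 : ENNReal) = ENNReal.ofReal 2 by simp]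
  refine ENNReal.ofReal_le_ofReal ?_
  rw [inv_mul_le_iff₀ (by positivity)]
  rw [show (2 : ℝ) = Real.sqrt 4 by rw [show (4 : ℝ) = 2 ^ 2 by norm_num]; simp]
  rw [← Real.sqrt_mul (by positivity)]
  refine Real.sqrt_le_sqrt ?_
  rw [← show (2 : ℝ) = Real.sqrt 4 by rw [show (4 : ℝ) = 2 ^ 2 by norm_num]; simp]
  nlinarith [Real.pi_pos]

lemma lintegral_pi_gaussian_prod {p : ℕ} (A : Finset (Fin p)) (F : Fin p → ℝ → ENNReal)
    (hF : ∀ j, Measurable (F j)) :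
    ∫⁻ g, ∏ j ∈ A, F j (g j) ∂(Measure.pi fun _ : Fin p => gaussianReal 0 1)
      = ∏ j ∈ A, ∫⁻ x, F j x ∂(gaussianReal 0 1) := by
  rw [lintegral_prod_eq_prod_lintegral_of_indepFun A (fun j (g : Fin p → ℝ) => F j (g j))
    (iIndepFun_pi (X := F) fun j => (hF j).aemeasurable) (fun j => (hF j).comp (measurable_pi_apply j))]
  refine Finset.prod_congr rfl fun j _ => ?_
  exact (measurePreserving_eval (fun _ : Fin p => gaussianReal 0 1) j).lintegral_comp (hF j)

section Quadratic

variable {Ω : Type*} [MeasurableSpace Ω] {μ : Measure Ω} [IsProbabilityMeasure μ]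
  {n p : ℕ} {ξ : Fin n → Ω → ℝ} {σ : ℝ}

lemma sum_transpose_mulVec_mul (X : Matrix (Fin n) (Fin p) ℝ) (x : Fin n → ℝ) (u : Fin p → ℝ) :
    ∑ j, X.transpose.mulVec x j * u j = ∑ i, X.mulVec u i * x i := by
  simp only [Matrix.mulVec, dotProduct, Matrix.transpose_apply, Finset.sum_mul]
  rw [Finset.sum_comm]
  exact Finset.sum_congr rfl fun i _ => Finset.sum_congr rfl fun j _ => by ring

/-- Decoupling: the exponential of a square is a Gaussian average of exponentials of linear forms.
After swapping integrals, the noise sees only a linear form, and the remaining Gaussian integral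
factors over `A`. -/
lemma IsSubGaussianNoise.lintegral_exp_sq_transpose_mulVec_le (hξ : IsSubGaussianNoise μ ξ σ)
    (hσ : 0 < σ) (hn : 0 < n) (X : Matrix (Fin n) (Fin p) ℝ) (A : Finset (Fin p))
    (hA : ∀ u : Fin p → ℝ, supp u ⊆ A → sqNorm (X.mulVec u) ≤ 2 * (n * sqNorm u)) :
    ∫⁻ ω, ENNReal.ofReal (Real.exp
        ((∑ j ∈ A, X.transpose.mulVec (fun i => ξ i ω) j ^ 2) / (128 * σ ^ 2 * n))) ∂μ
      ≤ 2 ^ A.card := by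
  have hn' : (0 : ℝ) < n := by exact_mod_cast hn
  -- Here `r²/2 = 1/(128σ²n)` recovers the quadratic form, and `8σ² · 2n · r² = 1/4` keeps the
  -- Gaussian integral finite.
  set r : ℝ := (8 * σ * Real.sqrt n)⁻¹ with hr
  have hr2 : r ^ 2 = 1 / (64 * σ ^ 2 * n) := by
    rw [hr, inv_pow, mul_pow, mul_pow, Real.sq_sqrt hn'.le]; norm_num
  set γ := Measure.pi fun _ : Fin p => gaussianReal 0 1 with hγ
  set U : (Fin p → ℝ) → Fin p → ℝ := fun g j => if j ∈ A then r * g j else 0 with hU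
  have hdec : ∀ ω, ENNReal.ofReal (Real.exp
        ((∑ j ∈ A, X.transpose.mulVec (fun i => ξ i ω) j ^ 2) / (128 * σ ^ 2 * n)))
      = ∫⁻ g, ENNReal.ofReal (Real.exp (∑ i, X.mulVec (U g) i * ξ i ω)) ∂γ := by
    intro ω
    have e1 : ∀ g, ENNReal.ofReal (Real.exp (∑ i, X.mulVec (U g) i * ξ i ω))
        = ∏ j ∈ A, ENNReal.ofReal
          (Real.exp (r * X.transpose.mulVec (fun i => ξ i ω) j * g j)) := by
      intro g
      rw [← ENNReal.ofReal_prod_of_nonneg fun j _ => (Real.exp_pos _).le, ← Real.exp_sum,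
        ← sum_transpose_mulVec_mul X (fun i => ξ i ω)]
      congr 2
      simp only [hU, mul_ite, mul_zero, Finset.sum_ite_mem, Finset.univ_inter]
      exact Finset.sum_congr rfl fun j _ => by ring
    simp_rw [e1]
    rw [lintegral_pi_gaussian_prod A (fun j x => ENNReal.ofReal
          (Real.exp (r * X.transpose.mulVec (fun i => ξ i ω) j * x))) fun j => by fun_prop]
    simp_rw [lintegral_exp_mul_gaussianReal]
    rw [← ENNReal.ofReal_prod_of_nonneg fun j _ => (Real.exp_pos _).le, ← Real.exp_sum,
      Finset.sum_div]
    congr 2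
    refine Finset.sum_congr rfl fun j _ => ?_
    rw [mul_pow, hr2]
    field_simp
    ring
  have hUm : Measurable U := by
    refine measurable_pi_lambda _ fun j => ?_
    by_cases hj : j ∈ A <;> simp only [hU, hj, if_true, if_false] <;> fun_prop
  simp_rw [hdec]
  rw [lintegral_lintegral_swap]
  · calc ∫⁻ g, ∫⁻ ω, ENNReal.ofReal (Real.exp (∑ i, X.mulVec (U g) i * ξ i ω)) ∂μ ∂γ
        ≤ ∫⁻ g, ∏ j ∈ A, ENNReal.ofReal (Real.exp (g j ^ 2 / 4)) ∂γ := by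
          refine lintegral_mono fun g => ?_
          refine (hξ.lintegral_exp_linear_le hσ _).trans ?_
          rw [← ENNReal.ofReal_prod_of_nonneg fun j _ => (Real.exp_pos _).le, ← Real.exp_sum]
          refine ENNReal.ofReal_le_ofReal (Real.exp_le_exp.2 ?_)
          have hs : supp (U g) ⊆ A := fun j hj => by
            by_contra hjA
            simp [supp, hU, hjA] at hj
          have hn2 : sqNorm (U g) = (∑ j ∈ A, g j ^ 2) / (64 * σ ^ 2 * n) := by
            simp only [sqNorm, hU, ite_pow, mul_pow, hr2]
            simp only [ne_eq, OfNat.ofNat_ne_zero, not_false_eq_true, zero_pow,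
              Finset.sum_ite_mem, Finset.univ_inter, Finset.sum_div]
            exact Finset.sum_congr rfl fun j _ => by ring
          calc 8 * σ ^ 2 * sqNorm (X.mulVec (U g))
              ≤ 8 * σ ^ 2 * (2 * (n * sqNorm (U g))) := by gcongr; exact hA _ hs
            _ = ∑ j ∈ A, g j ^ 2 / 4 := by
              rw [hn2, ← Finset.sum_div]; field_simp; ring
      _ = ∏ j ∈ A, ∫⁻ x, ENNReal.ofReal (Real.exp (x ^ 2 / 4)) ∂(gaussianReal 0 1) :=
          lintegral_pi_gaussian_prod A (fun _ x => ENNReal.ofReal (Real.exp (x ^ 2 / 4)))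
            fun j => by fun_prop
      _ ≤ 2 ^ A.card := by
          rw [Finset.prod_const]
          exact pow_le_pow_left' lintegral_exp_sq_div_four_gaussianReal_le _
  · refine Measurable.aemeasurable ?_
    refine (Real.measurable_exp.comp ?_).ennreal_ofReal
    refine Finset.measurable_sum _ fun i _ => ?_
    refine Measurable.mul ?_ ((hξ.measurable i).comp measurable_fst)
    simp only [Matrix.mulVec, dotProduct]
    exact Finset.measurable_sum _ fun j _ =>
      (((measurable_pi_apply j).comp hUm).comp measurable_snd).const_mul _

lemma IsSubGaussianNoise.measureReal_sq_transpose_mulVec_ge_le (hξ : IsSubGaussianNoise μ ξ σ)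
    (hσ : 0 < σ) (hn : 0 < n) (X : Matrix (Fin n) (Fin p) ℝ) (A : Finset (Fin p))
    (hA : ∀ u : Fin p → ℝ, supp u ⊆ A → sqNorm (X.mulVec u) ≤ 2 * (n * sqNorm u)) (v : ℝ) :
    μ.real {ω | 128 * σ ^ 2 * n * v ≤ ∑ j ∈ A, X.transpose.mulVec (fun i => ξ i ω) j ^ 2}
      ≤ 2 ^ A.card * Real.exp (-v) := by
  have hn' : (0 : ℝ) < n := by exact_mod_cast hn
  have hmeasT : ∀ j, Measurable fun ω => X.transpose.mulVec (fun i => ξ i ω) j := fun j => by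
    simp only [Matrix.mulVec, dotProduct]
    exact Finset.measurable_sum _ fun i _ => (hξ.measurable i).const_mul _
  have hI := hξ.lintegral_exp_sq_transpose_mulVec_le hσ hn X A hA
  set Q : Ω → ℝ := fun ω => ∑ j ∈ A, X.transpose.mulVec (fun i => ξ i ω) j ^ 2 with hQ
  have hQm : Measurable Q := Finset.measurable_sum _ fun j _ => (hmeasT j).pow_const 2
  have hM := mul_meas_ge_le_lintegral (μ := μ)
    (f := fun ω => ENNReal.ofReal (Real.exp (Q ω / (128 * σ ^ 2 * n)))) (by fun_prop)
    (ENNReal.ofReal (Real.exp v))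
  have hsub : {ω | 128 * σ ^ 2 * n * v ≤ Q ω} ⊆
      {ω | ENNReal.ofReal (Real.exp v) ≤ ENNReal.ofReal (Real.exp (Q ω / (128 * σ ^ 2 * n)))} := by
    intro ω hω
    refine ENNReal.ofReal_le_ofReal (Real.exp_le_exp.2 ?_)
    rw [le_div_iff₀ (by positivity)]
    have : 128 * σ ^ 2 * n * v ≤ Q ω := hω
    linarith
  have h1 : ENNReal.ofReal (Real.exp v) * μ {ω | 128 * σ ^ 2 * n * v ≤ Q ω} ≤ 2 ^ A.card :=
    ((mul_le_mul_right (measure_mono hsub) _).trans hM).trans hI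
  have h2 := ENNReal.toReal_mono (by simp) h1
  rw [ENNReal.toReal_mul, ENNReal.toReal_ofReal (Real.exp_pos _).le] at h2
  simp only [ENNReal.toReal_pow, ENNReal.toReal_ofNat] at h2
  rw [Real.exp_neg, ← div_eq_mul_inv, le_div_iff₀ (Real.exp_pos _), mul_comm]
  exact h2

end Quadratic

end HTP

namespace HTP

/-! ### Deterministic analysis of one iteration -/

section Algebra

variable {m : ℕ}

lemma sqNorm_nonneg (v : Fin m → ℝ) : 0 ≤ sqNorm v := Finset.sum_nonneg fun _ _ => sq_nonneg _

lemma sqNorm_add (u v : Fin m → ℝ) :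
    sqNorm (u + v) = sqNorm u + 2 * ∑ i, u i * v i + sqNorm v := by
  simp only [sqNorm, Finset.mul_sum, ← Finset.sum_add_distrib, Pi.add_apply]
  exact Finset.sum_congr rfl fun i _ => by ring

lemma sqNorm_sub (u v : Fin m → ℝ) :
    sqNorm (u - v) = sqNorm u - 2 * ∑ i, u i * v i + sqNorm v := by
  simp only [sqNorm, Finset.mul_sum, ← Finset.sum_add_distrib, ← Finset.sum_sub_distrib,
    Pi.sub_apply]
  exact Finset.sum_congr rfl fun i _ => by ring

lemma sqNorm_smul (c : ℝ) (u : Fin m → ℝ) : sqNorm (c • u) = c ^ 2 * sqNorm u := by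
  simp only [sqNorm, Finset.mul_sum, Pi.smul_apply, smul_eq_mul, mul_pow]

lemma mem_supp {v : Fin m → ℝ} {i : Fin m} : i ∈ supp v ↔ v i ≠ 0 := by simp [supp]

lemma supp_sub_subset (u v : Fin m → ℝ) : supp (u - v) ⊆ supp u ∪ supp v := by
  intro i hi
  rw [Finset.mem_union, mem_supp, mem_supp]
  rw [mem_supp, Pi.sub_apply] at hi
  by_contra! h
  exact hi (by rw [h.1, h.2, sub_zero])

lemma supp_add_subset (u v : Fin m → ℝ) : supp (u + v) ⊆ supp u ∪ supp v := by
  intro i hi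
  rw [Finset.mem_union, mem_supp, mem_supp]
  rw [mem_supp, Pi.add_apply] at hi
  by_contra! h
  exact hi (by rw [h.1, h.2, add_zero])

end Algebra

variable {n p : ℕ} {X : Matrix (Fin n) (Fin p) ℝ}

/-- Under the restricted isometry property, `I - XᵀX/n` is small on sparse vectors. -/
lemma RIP.sum_sq_sub_gram_le {k : ℕ} {δ : ℝ} (hX : RIP X k δ) (hn : 0 < n)
    {B U : Finset (Fin p)} (hcard : (B ∪ U).card ≤ k) {u : Fin p → ℝ} (hu : supp u ⊆ U) :
    ∑ i ∈ B, (u i - X.transpose.mulVec (X.mulVec u) i / n) ^ 2 ≤ δ ^ 2 * sqNorm u := by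
  obtain ⟨hδ, -, hrip⟩ := hX
  have hn' : (0 : ℝ) < n := by exact_mod_cast hn
  set z : Fin p → ℝ := fun i => u i - X.transpose.mulVec (X.mulVec u) i / n with hz
  set h : Fin p → ℝ := fun i => if i ∈ B then z i else 0 with hh
  -- Polarization: isometry is tested on `u ± a`. The scale `δ⁻¹` balances the two norms, since the
  -- restriction `h` turns out to have norm at most `δ‖u‖`.
  set a : Fin p → ℝ := δ⁻¹ • h with ha
  have hsa : supp a ⊆ B := fun i hi => by
    by_contra hiB
    simp [mem_supp, ha, hh, hiB] at hi
  have hsub : supp u ∪ supp a ⊆ B ∪ U := by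
    rw [Finset.union_comm B]
    exact Finset.union_subset_union hu hsa
  have hup := (hrip _ hcard (u - a) ((supp_sub_subset u a).trans hsub)).2
  have hlo := (hrip _ hcard (u + a) ((supp_add_subset u a).trans hsub)).1
  rw [Matrix.mulVec_sub, sqNorm_sub, sqNorm_sub] at hup
  rw [Matrix.mulVec_add, sqNorm_add, sqNorm_add] at hlo
  have hN : sqNorm h = ∑ i ∈ B, z i ^ 2 := by
    simp [sqNorm, hh, ite_pow, Finset.sum_ite_mem]
  have hX2 : ∑ i, X.mulVec u i * X.mulVec a i
      = ∑ j, X.transpose.mulVec (X.mulVec u) j * a j := by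
    rw [sum_transpose_mulVec_mul]
    exact Finset.sum_congr rfl fun i _ => mul_comm _ _
  have hin : n * ∑ i, u i * a i - ∑ i, X.mulVec u i * X.mulVec a i = n * (δ⁻¹ * sqNorm h) := by
    rw [hX2, Finset.mul_sum, ← Finset.sum_sub_distrib, sqNorm, Finset.mul_sum, Finset.mul_sum]
    refine Finset.sum_congr rfl fun i _ => ?_
    by_cases hi : i ∈ B
    · simp only [ha, hh, hz, Pi.smul_apply, smul_eq_mul, hi, if_true]
      field_simp
    · simp [ha, hh, hi]
  have ha2 : sqNorm a = (δ⁻¹) ^ 2 * sqNorm h := sqNorm_smul _ _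
  set I := ∑ i, u i * a i
  set J := ∑ i, X.mulVec u i * X.mulVec a i
  have h1 : n * (4 * (δ⁻¹ * sqNorm h)) ≤ n * (2 * δ * (sqNorm u + (δ⁻¹) ^ 2 * sqNorm h)) := by
    rw [← ha2]
    linarith
  have h2 := le_of_mul_le_mul_left h1 hn'
  have h3 : 2 * δ * (sqNorm u + (δ⁻¹) ^ 2 * sqNorm h)
      = 2 * δ * sqNorm u + 2 * (δ⁻¹ * sqNorm h) := by field_simp
  have h4 : δ⁻¹ * sqNorm h ≤ δ * sqNorm u := by linarith
  have h5 : sqNorm h ≤ δ * (δ * sqNorm u) := by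
    rwa [inv_mul_le_iff₀ hδ] at h4
  rw [← hN]
  linarith

/-- Truth, plus an error that the restricted isometry contracts, plus noise. -/
lemma gradStep_eq (βs b : Fin p → ℝ) (e : Fin n → ℝ) (i : Fin p) :
    gradStep X (X.mulVec βs + e) b i
      = βs i + ((b - βs) i - X.transpose.mulVec (X.mulVec (b - βs)) i / n)
        + X.transpose.mulVec e i / n := by
  have h : X.mulVec βs + e - X.mulVec b = e - X.mulVec (b - βs) := by
    rw [Matrix.mulVec_sub]; abel
  rw [gradStep, h, Matrix.mulVec_sub]
  simp only [Pi.sub_apply]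
  ring

/-- The normal equations of a least-squares fit restricted to a support set. -/
lemma transpose_mulVec_residual_eq_zero (hn : 0 < n)
    (hcol : ∀ j, sqNorm (fun i => X i j) = n) {y : Fin n → ℝ} {b : Fin p → ℝ}
    {S : Finset (Fin p)} (hb : supp b ⊆ S)
    (hmin : ∀ u : Fin p → ℝ, supp u ⊆ S → sqNorm (y - X.mulVec b) ≤ sqNorm (y - X.mulVec u))
    {j : Fin p} (hj : j ∈ S) : X.transpose.mulVec (y - X.mulVec b) j = 0 := by
  have hn' : (0 : ℝ) < n := by exact_mod_cast hn
  set g := X.transpose.mulVec (y - X.mulVec b) j with hg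
  -- The exact minimizer along coordinate `j`, as the column has squared norm `n`; it would lower
  -- the objective by `g²/n`.
  set e : Fin p → ℝ := Pi.single j (g / n) with he
  have hse : supp (b + e) ⊆ S := by
    refine (supp_add_subset b e).trans (Finset.union_subset hb fun i hi => ?_)
    rw [mem_supp, he] at hi
    by_cases hij : i = j
    · rwa [hij]
    · simp [hij] at hi
  have h := hmin _ hse
  have hXe : X.mulVec e = (g / n) • fun i => X i j := by
    ext i
    simp only [he, Matrix.mulVec_single, Pi.smul_apply, smul_eq_mul, MulOpposite.op_div,
      Matrix.col_apply]
    simp [div_eq_mul_inv, mul_comm]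
  have hg2 : ∑ i, (y - X.mulVec b) i * X i j = g := by
    rw [hg]
    simp only [Matrix.mulVec, dotProduct, Matrix.transpose_apply]
    exact Finset.sum_congr rfl fun i _ => mul_comm _ _
  rw [Matrix.mulVec_add, ← sub_sub, sqNorm_sub (y - X.mulVec b), hXe, sqNorm_smul, hcol] at h
  have h3 : ∑ i, (y - X.mulVec b) i * ((g / n) • fun i => X i j) i = g / n * g := by
    rw [← hg2, Finset.mul_sum]
    refine Finset.sum_congr rfl fun i _ => ?_
    simp only [Pi.smul_apply, smul_eq_mul]
    ring
  rw [h3] at h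
  have h4 : (g / n) ^ 2 * n = g / n * g := by field_simp
  have h5 : g / n * g = g ^ 2 / n := by ring
  rw [h4, h5] at h
  have h6 : g ^ 2 / n ≤ 0 := by linarith
  have h7 : g ^ 2 ≤ 0 := by
    by_contra! hc
    exact absurd h6 (not_le.2 (div_pos hc hn'))
  exact pow_eq_zero_iff (two_ne_zero) |>.1 (le_antisymm h7 (sq_nonneg g))

lemma sq_le_of_half_le {a x y z : ℝ} (h : |a| / 2 ≤ |x| + |y| + |z|) :
    a ^ 2 ≤ 12 * x ^ 2 + 12 * (y ^ 2 + z ^ 2) := by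
  rw [← sq_abs a, ← sq_abs x, ← sq_abs y, ← sq_abs z]
  nlinarith [sq_nonneg (|x| - |y|), sq_nonneg (|y| - |z|), sq_nonneg (|x| - |z|),
    abs_nonneg a, abs_nonneg x, abs_nonneg y, abs_nonneg z]

/-- Energy of the strong signals missed by hard thresholding: the noise does not enter, since it is
dominated by the strong signals. Here `z` is the error carried over from the previous iterate. -/
lemma sum_sq_missed_le {s : ℕ} {S₁ T : Finset (Fin p)} {βs z e v : Fin p → ℝ} {L : ℝ}
    (hv : ∀ i, v i = βs i + z i + e i) (he : ∀ i, |e i| ≤ L)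
    (hS₁ : ∀ i ∈ S₁, 4 * L ≤ |βs i|) (hs : S₁.card ≤ s) (hT : T.card = min s p)
    (hvT : ∀ i ∈ T, ∀ j ∉ T, |v j| ≤ |v i|) :
    ∑ i ∈ S₁.filter (fun i => i ∉ T ∨ v i = 0), βs i ^ 2
      ≤ 12 * (∑ i ∈ S₁ ∪ T, z i ^ 2 + ∑ i ∈ S₁ᶜ, βs i ^ 2) := by
  classical
  -- A kept coordinate whose value is zero also leaves the support, so it counts as missed.
  set M := S₁.filter (fun i => i ∉ T ∨ v i = 0) with hM
  have hcard : (S₁ \ T).card ≤ (T \ S₁).card := by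
    rw [Finset.card_sdiff_le_card_sdiff_iff, hT]
    exact le_min hs (by simpa using Finset.card_le_univ S₁)
  rcases isEmpty_or_nonempty (Fin p) with hp | hp
  · rw [Finset.eq_empty_of_isEmpty M, Finset.sum_empty]
    positivity
  -- Each strong signal outside `T` is charged to its own false positive, which won the comparison
  -- and lies outside `S₁`.
  obtain ⟨φ, hφm, hφi⟩ := (S₁ \ T).finite_toSet.exists_injOn_of_encard_le
    (t := ((T \ S₁ : Finset (Fin p)) : Set (Fin p))) (by
      rw [Set.encard_coe_eq_coe_finsetCard, Set.encard_coe_eq_coe_finsetCard]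
      exact_mod_cast hcard)
  have hφ : ∀ i ∈ S₁ \ T, φ i ∈ T \ S₁ := fun i hi => by
    have := hφm (Finset.mem_coe.2 hi)
    simpa using this
  have hpt : ∀ i ∈ M, βs i ^ 2 ≤ 12 * z i ^ 2
      + if i ∈ S₁ \ T then 12 * (z (φ i) ^ 2 + βs (φ i) ^ 2) else 0 := by
    intro i hi
    obtain ⟨hi1, hi2⟩ := Finset.mem_filter.1 hi
    have hstrong := hS₁ i hi1
    have hβ : |βs i| ≤ |v i| + |z i| + |e i| := by
      have : βs i = v i - z i - e i := by rw [hv]; ring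
      rw [this]
      exact (abs_sub _ _).trans (add_le_add_left (abs_sub _ _) _)
    by_cases hiT : i ∈ T
    · have hvi : v i = 0 := hi2.resolve_left (not_not.2 hiT)
      rw [if_neg (by simp [hiT])]
      rw [hvi, abs_zero, zero_add] at hβ
      have := sq_le_of_half_le (a := βs i) (x := z i) (y := 0) (z := 0)
        (by simp only [abs_zero, add_zero]; linarith [he i, abs_nonneg (βs i)])
      simpa using this
    · have hmem : i ∈ S₁ \ T := Finset.mem_sdiff.2 ⟨hi1, hiT⟩
      rw [if_pos hmem]
      have hj := Finset.mem_sdiff.1 (hφ i hmem)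
      have hvv := hvT _ hj.1 i hiT
      have hvj : |v (φ i)| ≤ |βs (φ i)| + |z (φ i)| + |e (φ i)| := by
        rw [hv]
        exact (abs_add_le _ _).trans (add_le_add_left (abs_add_le _ _) _)
      exact sq_le_of_half_le (by linarith [he i, he (φ i)])
  have hsubM : S₁ \ T ⊆ M := fun i hi => by
    obtain ⟨h1, h2⟩ := Finset.mem_sdiff.1 hi
    exact Finset.mem_filter.2 ⟨h1, Or.inl h2⟩
  have hre : ∀ f : Fin p → ℝ, (∀ i, 0 ≤ f i) → ∑ i ∈ S₁ \ T, f (φ i) ≤ ∑ i ∈ T \ S₁, f i := by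
    intro f hf
    rw [← Finset.sum_image (f := f) (s := S₁ \ T) (g := φ) (by simpa using hφi)]
    refine Finset.sum_le_sum_of_subset_of_nonneg ?_ fun i _ _ => hf i
    intro j hj
    obtain ⟨i, hi, rfl⟩ := Finset.mem_image.1 hj
    exact hφ i hi
  have hzM : ∑ i ∈ M, z i ^ 2 ≤ ∑ i ∈ S₁, z i ^ 2 :=
    Finset.sum_le_sum_of_subset_of_nonneg (Finset.filter_subset _ _) fun _ _ _ => sq_nonneg _
  have hunion : ∑ i ∈ S₁ ∪ T, z i ^ 2 = ∑ i ∈ S₁, z i ^ 2 + ∑ i ∈ T \ S₁, z i ^ 2 := by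
    rw [← Finset.union_sdiff_self_eq_union, Finset.sum_union Finset.disjoint_sdiff]
  have hβ : ∑ i ∈ T \ S₁, βs i ^ 2 ≤ ∑ i ∈ S₁ᶜ, βs i ^ 2 :=
    Finset.sum_le_sum_of_subset_of_nonneg
      (fun i hi => Finset.mem_compl.2 (Finset.mem_sdiff.1 hi).2) fun _ _ _ => sq_nonneg _
  calc ∑ i ∈ M, βs i ^ 2
      ≤ ∑ i ∈ M, (12 * z i ^ 2
        + if i ∈ S₁ \ T then 12 * (z (φ i) ^ 2 + βs (φ i) ^ 2) else 0) := Finset.sum_le_sum hpt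
    _ = 12 * ∑ i ∈ M, z i ^ 2 + 12 * (∑ i ∈ S₁ \ T, (z (φ i) ^ 2 + βs (φ i) ^ 2)) := by
        rw [Finset.sum_add_distrib, ← Finset.mul_sum, Finset.sum_ite_mem,
          Finset.inter_eq_right.2 hsubM, ← Finset.mul_sum]
    _ ≤ 12 * ∑ i ∈ S₁, z i ^ 2 + 12 * (∑ i ∈ T \ S₁, (z i ^ 2 + βs i ^ 2)) := by
        have := hre (fun i => z i ^ 2 + βs i ^ 2) fun i => by positivity
        gcongr
    _ ≤ _ := by
        rw [hunion, Finset.sum_add_distrib]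
        linarith

/-- Energy of the noise on a selected support exceeding the strong signals by `τ` plus the number of
missed strong signals. -/
lemma sum_sq_noise_le {τ : ℕ} {S₁ S M : Finset (Fin p)} {βs e : Fin p → ℝ} {L R : ℝ}
    (he : ∀ i, |e i| ≤ L) (hM : ∀ i ∈ M, 4 * L ≤ |βs i|) (hL : 0 ≤ L)
    (hR : ∀ A : Finset (Fin p), A.card ≤ τ → ∑ i ∈ S₁ ∪ A, e i ^ 2 ≤ R)
    (hcard : (S \ S₁).card ≤ τ + M.card) :
    ∑ i ∈ S, e i ^ 2 ≤ R + (∑ i ∈ M, βs i ^ 2) / 16 := by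
  classical
  -- Up to `τ` of the extra coordinates go into `A`; the leftovers are no more than the missed
  -- signals.
  obtain ⟨A, hAS, hA⟩ := Finset.exists_subset_card_eq
    (show min τ (S \ S₁).card ≤ (S \ S₁).card from min_le_right _ _)
  have hB : ((S \ S₁) \ A).card ≤ M.card := by
    rw [Finset.card_sdiff_of_subset hAS, hA]
    omega
  have hsub : S ⊆ (S₁ ∪ A) ∪ ((S \ S₁) \ A) := by
    intro i hi
    simp only [Finset.mem_union, Finset.mem_sdiff]
    tauto
  have h2 : ∑ i ∈ (S \ S₁) \ A, e i ^ 2 ≤ (∑ i ∈ M, βs i ^ 2) / 16 := by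
    calc ∑ i ∈ (S \ S₁) \ A, e i ^ 2 ≤ ((S \ S₁) \ A).card • L ^ 2 :=
          Finset.sum_le_card_nsmul _ _ _ fun i _ => by
            rw [← sq_abs]; exact pow_le_pow_left₀ (abs_nonneg _) (he i) 2
      _ ≤ M.card • L ^ 2 := nsmul_le_nsmul_left (sq_nonneg _) hB
      _ ≤ ∑ i ∈ M, βs i ^ 2 / 16 := by
          refine Finset.card_nsmul_le_sum _ _ _ fun i hi => ?_
          have := pow_le_pow_left₀ (by positivity) (hM i hi) 2
          rw [sq_abs] at this
          linarith
      _ = _ := by rw [Finset.sum_div]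
  calc ∑ i ∈ S, e i ^ 2 ≤ ∑ i ∈ (S₁ ∪ A) ∪ ((S \ S₁) \ A), e i ^ 2 :=
        Finset.sum_le_sum_of_subset_of_nonneg hsub fun _ _ _ => sq_nonneg _
    _ ≤ ∑ i ∈ S₁ ∪ A, e i ^ 2 + ∑ i ∈ (S \ S₁) \ A, e i ^ 2 := by
        have := Finset.sum_union_inter (s₁ := S₁ ∪ A) (s₂ := (S \ S₁) \ A)
          (f := fun i => e i ^ 2)
        have h0 : 0 ≤ ∑ i ∈ (S₁ ∪ A) ∩ ((S \ S₁) \ A), e i ^ 2 :=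
          Finset.sum_nonneg fun _ _ => sq_nonneg _
        linarith
    _ ≤ _ := add_le_add (hR A (by omega)) h2

/-- One iteration contracts the squared error, up to the noise level `R` and the weak signals. -/
lemma IsStep.sqNorm_sub_le {τ s : ℕ} {δ : ℝ} {S₁ : Finset (Fin p)} {βs b b' : Fin p → ℝ}
    {x : Fin n → ℝ} {L R : ℝ} (hn : 0 < n) (hcol : ∀ j, sqNorm (fun i => X i j) = n)
    (hs : s = S₁.card + τ) (hδ : δ < 0.005) (hX : RIP X (3 * max s (supp βs).card) δ)
    (hS₁s : S₁ ⊆ supp βs)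
    (he : ∀ i, |X.transpose.mulVec x i / n| ≤ L) (hL : 0 ≤ L)
    (hS₁ : ∀ i ∈ S₁, 4 * L ≤ |βs i|)
    (hR : ∀ A : Finset (Fin p), A.card ≤ τ →
      ∑ i ∈ S₁ ∪ A, (X.transpose.mulVec x i / n) ^ 2 ≤ R)
    (hb : (supp b).card ≤ s) (hstep : IsStep X (X.mulVec βs + x) s b b') :
    (supp b').card ≤ s ∧
      sqNorm (b' - βs) ≤ sqNorm (b - βs) / 3 + 3 * R + 20 * ∑ i ∈ S₁ᶜ, βs i ^ 2 := by
  classical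
  obtain ⟨w, ⟨T, hT, hvT, hw⟩, hb'w, hmin⟩ := hstep
  set v := gradStep X (X.mulVec βs + x) b with hv
  set e : Fin p → ℝ := fun i => X.transpose.mulVec x i / n with hedef
  set z : Fin p → ℝ := fun i => (b - βs) i - X.transpose.mulVec (X.mulVec (b - βs)) i / n with hz
  have hδ0 := hX.1
  have hwT : supp w ⊆ T := fun i hi => by
    rw [mem_supp, hw] at hi
    by_contra h
    simp [h] at hi
  have hTs : T.card ≤ s := hT ▸ min_le_left _ _
  have hws : (supp w).card ≤ s := (Finset.card_le_card hwT).trans hTs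
  have hb's : (supp b').card ≤ s := (Finset.card_le_card hb'w).trans hws
  refine ⟨hb's, ?_⟩
  set M := S₁.filter (fun i => i ∉ T ∨ v i = 0) with hM
  have hmiss := sum_sq_missed_le (z := z) (e := e) (v := v) (L := L) (T := T)
    (fun i => gradStep_eq βs b x i) he hS₁ (by omega) hT hvT
  have hz2 : ∑ i ∈ S₁ ∪ T, z i ^ 2 ≤ δ ^ 2 * sqNorm (b - βs) := by
    refine hX.sum_sq_sub_gram_le hn (U := supp b ∪ supp βs) ?_ (supp_sub_subset b βs)
    -- `supp βs` absorbs `S₁`, leaving three sets of size at most `max s (supp βs).card`; hence the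
    -- factor 3 in the isometry order.
    have hsub : (S₁ ∪ T) ∪ (supp b ∪ supp βs) ⊆ T ∪ supp b ∪ supp βs := by
      intro i hi
      have := @hS₁s i
      simp only [Finset.mem_union] at hi ⊢
      tauto
    have h1 := Finset.card_le_card hsub
    have h2 := Finset.card_union_le (T ∪ supp b) (supp βs)
    have h3 := Finset.card_union_le T (supp b)
    omega
  have hD2 : ∑ i ∈ supp w, ((b' - βs) i - X.transpose.mulVec (X.mulVec (b' - βs)) i / n) ^ 2
      ≤ δ ^ 2 * sqNorm (b' - βs) := by
    refine hX.sum_sq_sub_gram_le hn (U := supp b' ∪ supp βs) ?_ (supp_sub_subset b' βs)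
    have h1 := Finset.card_union_le (supp w) (supp b' ∪ supp βs)
    have h2 := Finset.card_union_le (supp b') (supp βs)
    omega
  have hnoise : ∑ i ∈ supp w, e i ^ 2 ≤ R + (∑ i ∈ M, βs i ^ 2) / 16 := by
    refine sum_sq_noise_le he (fun i hi => hS₁ i (Finset.mem_filter.1 hi).1) hL hR ?_
    have h1 : (supp w \ S₁).card ≤ (T \ S₁).card :=
      Finset.card_le_card (Finset.sdiff_subset_sdiff hwT le_rfl)
    have h2 : (S₁ \ T).card ≤ M.card := Finset.card_le_card fun i hi => by
      obtain ⟨h1, h2⟩ := Finset.mem_sdiff.1 hi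
      exact Finset.mem_filter.2 ⟨h1, Or.inl h2⟩
    have h3 := Finset.card_sdiff_add_card_inter T S₁
    have h4 := Finset.card_sdiff_add_card_inter S₁ T
    rw [Finset.inter_comm] at h4
    omega
  have hfit : ∑ i ∈ supp w, (b' - βs) i ^ 2
      ≤ 2 * ∑ i ∈ supp w, e i ^ 2 + 2 * (δ ^ 2 * sqNorm (b' - βs)) := by
    refine le_trans ?_ (add_le_add_right (mul_le_mul_of_nonneg_left hD2 zero_le_two) _)
    rw [Finset.mul_sum, Finset.mul_sum, ← Finset.sum_add_distrib]
    refine Finset.sum_le_sum fun i hi => ?_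
    -- On the fitted support the normal equations make the error equal to the noise plus the `I -
    -- XᵀX/n` image of the error itself.
    have h0 := transpose_mulVec_residual_eq_zero hn hcol hb'w hmin hi
    have hres : X.mulVec βs + x - X.mulVec b' = x - X.mulVec (b' - βs) := by
      rw [Matrix.mulVec_sub]; abel
    rw [hres, Matrix.mulVec_sub, Pi.sub_apply, sub_eq_zero] at h0
    have h1 : (b' - βs) i = e i
        + ((b' - βs) i - X.transpose.mulVec (X.mulVec (b' - βs)) i / n) := by
      simp only [hedef, h0]; ring
    set q := (b' - βs) i - X.transpose.mulVec (X.mulVec (b' - βs)) i / n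
    rw [h1]
    nlinarith [sq_nonneg (e i - q)]
  have hout : ∑ i ∈ (supp w)ᶜ, (b' - βs) i ^ 2 ≤ ∑ i ∈ M, βs i ^ 2 + ∑ i ∈ S₁ᶜ, βs i ^ 2 := by
    have hd : Disjoint M S₁ᶜ := Finset.disjoint_left.2 fun i hi hi' =>
      (Finset.mem_compl.1 hi') (Finset.mem_filter.1 hi).1
    rw [← Finset.sum_union hd]
    calc ∑ i ∈ (supp w)ᶜ, (b' - βs) i ^ 2 = ∑ i ∈ (supp w)ᶜ, βs i ^ 2 := by
          refine Finset.sum_congr rfl fun i hi => ?_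
          have h0 : b' i = 0 := by
            by_contra h
            exact (Finset.mem_compl.1 hi) (hb'w (mem_supp.2 h))
          rw [Pi.sub_apply, h0]; ring
      _ ≤ _ := by
          refine Finset.sum_le_sum_of_subset_of_nonneg (fun i hi => ?_) fun _ _ _ => sq_nonneg _
          rw [Finset.mem_compl, mem_supp, not_not, hw] at hi
          by_cases hiS : i ∈ S₁
          · refine Finset.mem_union_left _ (Finset.mem_filter.2 ⟨hiS, ?_⟩)
            by_cases hiT : i ∈ T
            · right; simpa [hiT] using hi
            · exact Or.inl hiT
          · exact Finset.mem_union_right _ (Finset.mem_compl.2 hiS)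
  have hsplit : sqNorm (b' - βs)
      = ∑ i ∈ supp w, (b' - βs) i ^ 2 + ∑ i ∈ (supp w)ᶜ, (b' - βs) i ^ 2 :=
    (Finset.sum_add_sum_compl _ _).symm
  -- With `m` the missed energy, `W` the weak energy and `D`, `D'` the old and new errors: `D' ≤ 2R
  -- + 9m/8 + W + 2δ²D'` and `m ≤ 12(δ²D + W)`. The tiny `δ²` leaves ample room.
  have hδ2 : δ ^ 2 ≤ 0.000025 := by nlinarith
  have hd := mul_le_mul_of_nonneg_right hδ2 (sqNorm_nonneg (b - βs))
  have hd' := mul_le_mul_of_nonneg_right hδ2 (sqNorm_nonneg (b' - βs))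
  have hW : 0 ≤ ∑ i ∈ S₁ᶜ, βs i ^ 2 := Finset.sum_nonneg fun _ _ => sq_nonneg _
  have hR0 : 0 ≤ R := (Finset.sum_nonneg fun _ _ => sq_nonneg _).trans (hR ∅ (by simp))
  have := sqNorm_nonneg (b - βs)
  have := sqNorm_nonneg (b' - βs)
  norm_num at hd hd'
  linarith

end HTP

namespace HTP

/-! ### The noise event -/

/-- Weighting sets by `x = k/p` costs `x⁻ᵗ` with exponent `t = τ`, at most `exp k` by the condition
on `τ`. The weighted sum over all sets is then `(1 + 2x)^p ≤ exp (2k)`. -/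
lemma sum_two_pow_card_le {p k τ : ℕ} (hk : 0 < k) (hkp : k < p)
    (hτ : (τ : ℝ) ≤ k / Real.log (p / k)) :
    ∑ A : Finset (Fin p) with A.card ≤ τ, (2 : ℝ) ^ A.card ≤ Real.exp (3 * k) := by
  have hk' : (0 : ℝ) < k := by exact_mod_cast hk
  have hkp' : (k : ℝ) < p := by exact_mod_cast hkp
  have hp' : (0 : ℝ) < p := hk'.trans hkp'
  have hlog : 0 < Real.log (p / k) := Real.log_pos (by rwa [one_lt_div hk'])
  rw [le_div_iff₀ hlog] at hτ
  set x : ℝ := k / p with hx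
  have hx0 : 0 < x := by positivity
  have hx1 : x ≤ 1 := (div_le_one hp').2 hkp'.le
  have hxτ : (x ^ τ)⁻¹ ≤ Real.exp k := by
    have : (x ^ τ)⁻¹ = Real.exp (τ * Real.log (p / k)) := by
      rw [Real.exp_nat_mul, Real.exp_log (by positivity), ← inv_pow, hx, inv_div]
    rw [this]
    exact Real.exp_le_exp.2 hτ
  have hbin : ∑ A : Finset (Fin p), (2 * x) ^ A.card ≤ Real.exp (2 * k) := by
    have h := Fintype.sum_pow_mul_eq_add_pow (Fin p) (2 * x) 1
    simp only [one_pow, mul_one, Fintype.card_fin] at h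
    rw [h]
    have h2 : (2 * k : ℝ) = p * (2 * x) := by rw [hx]; field_simp
    rw [h2, Real.exp_nat_mul]
    exact pow_le_pow_left₀ (by positivity) (Real.add_one_le_exp _) _
  calc ∑ A : Finset (Fin p) with A.card ≤ τ, (2 : ℝ) ^ A.card
      ≤ ∑ A : Finset (Fin p) with A.card ≤ τ, (x ^ τ)⁻¹ * (2 * x) ^ A.card := by
        refine Finset.sum_le_sum fun A hA => ?_
        have h1 : x ^ τ ≤ x ^ A.card :=
          pow_le_pow_of_le_one hx0.le hx1 (Finset.mem_filter.1 hA).2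
        rw [mul_pow, inv_mul_eq_div, le_div_iff₀ (by positivity)]
        gcongr
    _ ≤ ∑ A : Finset (Fin p), (x ^ τ)⁻¹ * (2 * x) ^ A.card :=
        Finset.sum_le_sum_of_subset_of_nonneg (Finset.filter_subset _ _)
          fun _ _ _ => by positivity
    _ = (x ^ τ)⁻¹ * ∑ A : Finset (Fin p), (2 * x) ^ A.card := by rw [Finset.mul_sum]
    _ ≤ Real.exp k * Real.exp (2 * k) := by gcongr
    _ = Real.exp (3 * k) := by rw [← Real.exp_add]; ring_nf

section Events

variable {Ω : Type*} [MeasurableSpace Ω] {μ : Measure Ω} [IsProbabilityMeasure μ]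
  {n p : ℕ} {ξ : Fin n → Ω → ℝ} {σ : ℝ} {X : Matrix (Fin n) (Fin p) ℝ}

lemma RIP.sqNorm_mulVec_le_two {k : ℕ} {δ : ℝ} (hX : RIP X k δ) {A : Finset (Fin p)}
    (hA : A.card ≤ k) (u : Fin p → ℝ) (hu : supp u ⊆ A) :
    sqNorm (X.mulVec u) ≤ 2 * (n * sqNorm u) := by
  refine (hX.2.2 A hA u hu).2.trans ?_
  have := sqNorm_nonneg u
  gcongr
  linarith [hX.2.1]

/-- The noise has small energy on the union of `S₁` with any `τ` further coordinates. -/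
lemma IsSubGaussianNoise.measureReal_exists_sum_sq_ge_le (hξ : IsSubGaussianNoise μ ξ σ)
    (hσ : 0 < σ) (hn : 0 < n) {k τ : ℕ} {δ : ℝ} (hX : RIP X k δ) {S₁ : Finset (Fin p)}
    (h0 : 0 < S₁.card) (h1 : S₁.card < p)
    (hτ : (τ : ℝ) ≤ S₁.card / Real.log (p / S₁.card)) (hk : S₁.card + τ ≤ k) :
    μ.real {ω | ∃ A : Finset (Fin p), A.card ≤ τ ∧ 128 * σ ^ 2 * n * (5 * S₁.card) ≤
        ∑ j ∈ S₁ ∪ A, X.transpose.mulVec (fun i => ξ i ω) j ^ 2}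
      ≤ Real.exp (-S₁.card) := by
  set E : Finset (Fin p) → Set Ω := fun A => {ω | 128 * σ ^ 2 * n * (5 * S₁.card) ≤
        ∑ j ∈ S₁ ∪ A, X.transpose.mulVec (fun i => ξ i ω) j ^ 2} with hE
  have hset : {ω | ∃ A : Finset (Fin p), A.card ≤ τ ∧ 128 * σ ^ 2 * n * (5 * S₁.card) ≤
        ∑ j ∈ S₁ ∪ A, X.transpose.mulVec (fun i => ξ i ω) j ^ 2}
      = ⋃ A ∈ (Finset.univ.filter fun A : Finset (Fin p) => A.card ≤ τ), E A := by
    ext ω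
    simp [hE]
  rw [hset]
  refine (measureReal_biUnion_finset_le _ _).trans ?_
  calc ∑ A : Finset (Fin p) with A.card ≤ τ, μ.real (E A)
      ≤ ∑ A : Finset (Fin p) with A.card ≤ τ,
          (2 : ℝ) ^ A.card * (2 ^ S₁.card * Real.exp (-(5 * S₁.card))) := by
        refine Finset.sum_le_sum fun A hA => ?_
        have hA' : A.card ≤ τ := (Finset.mem_filter.1 hA).2
        have hc := Finset.card_union_le S₁ A
        refine (hξ.measureReal_sq_transpose_mulVec_ge_le hσ hn X (S₁ ∪ A)
          (hX.sqNorm_mulVec_le_two (by omega)) _).trans ?_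
        rw [← mul_assoc, ← pow_add]
        gcongr
        · norm_num
        · omega
    _ = (∑ A : Finset (Fin p) with A.card ≤ τ, (2 : ℝ) ^ A.card)
          * (2 ^ S₁.card * Real.exp (-(5 * S₁.card))) := by rw [Finset.sum_mul]
    -- The 5 in the threshold pays 3 for the choice of `A`, 1 for `2 ^ |S₁|`, and leaves 1 for the
    -- tail.
    _ ≤ Real.exp (3 * S₁.card) * (Real.exp S₁.card * Real.exp (-(5 * S₁.card))) := by
        have h2 : (2 : ℝ) ^ S₁.card ≤ Real.exp S₁.card := by
          rw [← mul_one (S₁.card : ℝ), Real.exp_nat_mul]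
          refine pow_le_pow_left₀ (by norm_num) ?_ _
          have := Real.add_one_le_exp (1 : ℝ)
          linarith
        gcongr
        exact sum_two_pow_card_le h0 h1 hτ
    _ = Real.exp (-S₁.card) := by rw [← Real.exp_add, ← Real.exp_add]; ring_nf

/-- Uniform bound on the coordinates of the noise. -/
lemma IsSubGaussianNoise.measureReal_exists_sq_ge_le (hξ : IsSubGaussianNoise μ ξ σ)
    (hσ : 0 < σ) (hn : 0 < n) {k : ℕ} {δ : ℝ} (hX : RIP X k δ) (hk : 1 ≤ k) (hp : 2 ≤ p) :
    μ.real {ω | ∃ j, 128 * σ ^ 2 * n * (4 * Real.log p) ≤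
        X.transpose.mulVec (fun i => ξ i ω) j ^ 2} ≤ 1 / p := by
  have hp' : (2 : ℝ) ≤ p := by exact_mod_cast hp
  set E : Fin p → Set Ω := fun j => {ω | 128 * σ ^ 2 * n * (4 * Real.log p) ≤
        X.transpose.mulVec (fun i => ξ i ω) j ^ 2} with hE
  have hset : {ω | ∃ j, 128 * σ ^ 2 * n * (4 * Real.log p) ≤
        X.transpose.mulVec (fun i => ξ i ω) j ^ 2} = ⋃ j ∈ (Finset.univ : Finset (Fin p)), E j := by
    ext ω
    simp [hE]
  rw [hset]
  refine (measureReal_biUnion_finset_le _ _).trans ?_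
  have hexp : Real.exp (-(4 * Real.log p)) = ((p : ℝ) ^ 4)⁻¹ := by
    rw [Real.exp_neg, show 4 * Real.log p = (4 : ℕ) * Real.log p by norm_num, Real.exp_nat_mul,
      Real.exp_log (by linarith)]
  have hj : ∀ j, μ.real (E j) ≤ 2 * ((p : ℝ) ^ 4)⁻¹ := fun j => by
    have := hξ.measureReal_sq_transpose_mulVec_ge_le hσ hn X {j}
      (hX.sqNorm_mulVec_le_two (by simpa using hk)) (4 * Real.log p)
    simpa [hexp, hE] using this
  calc ∑ j, μ.real (E j) ≤ ∑ _j : Fin p, 2 * ((p : ℝ) ^ 4)⁻¹ := Finset.sum_le_sum fun j _ => hj j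
    _ = p * (2 * ((p : ℝ) ^ 4)⁻¹) := by simp
    _ ≤ 1 / p := by
        rw [le_div_iff₀ (by linarith)]
        have : (p : ℝ) * (2 * ((p : ℝ) ^ 4)⁻¹) * p = 2 / p ^ 2 := by field_simp
        rw [this, div_le_one (by positivity)]
        nlinarith

end Events

/-! ### Iterating -/

variable {n p : ℕ} {X : Matrix (Fin n) (Fin p) ℝ}

/-- Squared error along the iterations, on the noise event. -/
lemma sqNorm_iterate_sub_le {τ s : ℕ} {δ : ℝ} {S₁ : Finset (Fin p)} {βs : Fin p → ℝ}
    {x : Fin n → ℝ} {L R : ℝ} (hn : 0 < n) (hcol : ∀ j, sqNorm (fun i => X i j) = n)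
    (hs : s = S₁.card + τ) (hδ : δ < 0.005) (hX : RIP X (3 * max s (supp βs).card) δ)
    (hS₁s : S₁ ⊆ supp βs)
    (he : ∀ i, |X.transpose.mulVec x i / n| ≤ L) (hL : 0 ≤ L)
    (hS₁ : ∀ i ∈ S₁, 4 * L ≤ |βs i|)
    (hR : ∀ A : Finset (Fin p), A.card ≤ τ →
      ∑ i ∈ S₁ ∪ A, (X.transpose.mulVec x i / n) ^ 2 ≤ R)
    {β : ℕ → Fin p → ℝ} (h0 : (supp (β 0)).card ≤ s)
    (hstep : ∀ t, IsStep X (X.mulVec βs + x) s (β t) (β (t + 1))) (t : ℕ) :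
    (supp (β t)).card ≤ s ∧ sqNorm (β t - βs)
      ≤ Real.exp (-t) * sqNorm (β 0 - βs) + 2 * (3 * R + 20 * ∑ i ∈ S₁ᶜ, βs i ^ 2) := by
  have hW : 0 ≤ ∑ i ∈ S₁ᶜ, βs i ^ 2 := Finset.sum_nonneg fun _ _ => sq_nonneg _
  have hR0 : 0 ≤ R := (Finset.sum_nonneg fun _ _ => sq_nonneg _).trans (hR ∅ (by simp))
  induction t with
  | zero => exact ⟨h0, by simp; positivity⟩
  | succ t ih =>
    obtain ⟨h1, h2⟩ := (hstep t).sqNorm_sub_le hn hcol hs hδ hX hS₁s he hL hS₁ hR ih.1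
    refine ⟨h1, h2.trans ?_⟩
    -- The contraction factor `1/3` is below `1/e`; the floor `c` is stable because `2c/3 + c ≤ 2c`.
    have he3 : Real.exp (-t) / 3 ≤ Real.exp (-(t + 1 : ℕ)) := by
      have : Real.exp (-(t : ℝ)) = Real.exp (-(t + 1 : ℕ)) * Real.exp 1 := by
        rw [← Real.exp_add]; push_cast; ring_nf
      rw [this]
      have := Real.exp_one_lt_three
      have := Real.exp_pos (-((t + 1 : ℕ) : ℝ))
      nlinarith
    have := mul_le_mul_of_nonneg_right he3 (sqNorm_nonneg (β 0 - βs))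
    linarith [ih.2]

lemma strong_subset_supp (c : ℝ) (β : Fin p → ℝ) : strong c β ⊆ supp β :=
  Finset.filter_subset _ _

lemma sum_compl_strong (c : ℝ) (β : Fin p → ℝ) :
    ∑ i ∈ (strong c β)ᶜ, β i ^ 2 = ∑ i ∈ weak c β, β i ^ 2 := by
  symm
  refine Finset.sum_subset (fun i hi => ?_) fun i hi hi' => ?_
  · simp only [weak, strong, Finset.mem_filter, Finset.mem_compl] at hi ⊢
    intro h
    linarith [h.2]
  · simp only [weak, strong, Finset.mem_filter, Finset.mem_compl, not_and, not_le,
      not_lt, mem_supp] at hi hi'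
    by_contra h
    have hne : β i ≠ 0 := fun h' => h (by rw [h']; ring)
    linarith [hi hne, hi' hne]

end HTP

/-! ### Main theorem: choice of constants and assembly -/

theorem theorem6 :
    ∃ c₁ : ℝ, 0 < c₁ ∧ ∀ C₁ : ℝ, c₁ ≤ C₁ → ∀ C₀ : ℝ, 0 < C₀ →
    ∃ C₂ C₃ C₄ C₅ : ℝ, 0 < C₂ ∧ 0 < C₃ ∧ 0 < C₄ ∧ 0 < C₅ ∧
    ∀ (n p : ℕ) (_ : 0 < n)
      -- design with columns of norm `√n`, noise level, true coefficients
      (X : Matrix (Fin n) (Fin p) ℝ) (_ : ∀ j, HTP.sqNorm (fun i => X i j) = n)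
      (σ : ℝ) (_ : 0 < σ) (βs : Fin p → ℝ)
      -- strong and weak signals, model size
      (S₁ S₂ : Finset (Fin p))
      (_ : S₁ = HTP.strong (C₁ * σ * Real.sqrt (Real.log p / n)) βs)
      (_ : S₂ = HTP.weak (C₁ * σ * Real.sqrt (Real.log p / n)) βs)
      (τ s : ℕ) (_ : (τ : ℝ) ≤ S₁.card / Real.log (p / S₁.card)) (_ : s = S₁.card + τ)
      (δ : ℝ) (_ : δ < 0.005) (_ : HTP.RIP X (3 * max s (HTP.supp βs).card) δ)
      -- noise and the regression model
      (Ω : Type*) [MeasurableSpace Ω] (μ : Measure Ω) [IsProbabilityMeasure μ]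
      (ξ : Fin n → Ω → ℝ) (_ : HTP.IsSubGaussianNoise μ ξ σ)
      (y : Ω → Fin n → ℝ) (_ : ∀ ω, y ω = X.mulVec βs + fun i => ξ i ω)
      -- the iterates, started from a sparse initial estimator with the general minimax rate
      (β : ℕ → Ω → Fin p → ℝ)
      (_ : ∀ᵐ ω ∂μ, (HTP.supp (β 0 ω)).card ≤ s ∧
        HTP.sqNorm (β 0 ω - βs) ≤
          C₀ ^ 2 * (σ ^ 2 * (S₁.card * Real.log p / n) + ∑ i ∈ S₂, βs i ^ 2))
      (_ : ∀ᵐ ω ∂μ, ∀ t, HTP.IsStep X (y ω) s (β t ω) (β (t + 1) ω))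
      (t : ℕ) (_ : Real.log (C₂ ^ 2 * Real.log p) ≤ t),
      μ.real {ω | C₃ * (σ ^ 2 * (S₁.card / n) + ∑ i ∈ S₂, βs i ^ 2) ≤
          HTP.sqNorm (β t ω - βs)} ≤
        Real.exp (-(C₄ * S₁.card)) + ((S₁.card : ℝ) / p) ^ C₅ := by
  -- `92 = 4 · 23`, where `23² = 529` exceeds the `128 · 4` of the coordinate bound. `3881` exceeds
  -- `2 · 3 · 640`, the noise coefficient after iterating, and `2 · 20`, the weak one.
  refine ⟨92, by norm_num, fun C₁ hC₁ C₀ hC₀ =>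
    ⟨1, C₀ ^ 2 + 3881, 1, 1, one_pos, by positivity, one_pos, one_pos, ?_⟩⟩
  intro n p hn X hcol σ hσ βs S₁ S₂ hS₁ hS₂ τ s hτ hs δ hδ hX Ω _ μ _ ξ hξ y hy β hinit hstep t ht
  have hn' : (0 : ℝ) < n := by exact_mod_cast hn
  rw [one_mul, Real.rpow_one]
  -- If `|S₁|` is 0 or `p`, the right-hand side is at least 1; otherwise the counting bound over `A`
  -- applies.
  rcases Nat.eq_zero_or_pos S₁.card with h0 | h0
  · refine measureReal_le_one.trans ?_
    simp [h0]
  have hle : S₁.card ≤ p := by simpa using Finset.card_le_univ S₁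
  rcases hle.eq_or_lt with h1 | h1
  · have hp : (p : ℝ) ≠ 0 := by
      have : p ≠ 0 := by omega
      exact_mod_cast this
    refine measureReal_le_one.trans ?_
    rw [h1, div_self hp]
    linarith [Real.exp_pos (-(p : ℝ))]
  have h0' : (1 : ℝ) ≤ S₁.card := by exact_mod_cast h0
  have hp2 : 2 ≤ p := by omega
  have hp2' : (2 : ℝ) ≤ p := by exact_mod_cast hp2
  have hlogp : 0 < Real.log p := Real.log_pos (by linarith)
  have hk : S₁.card + τ ≤ 3 * max s (HTP.supp βs).card := by omega
  have hE₁ := hξ.measureReal_exists_sum_sq_ge_le hσ hn hX h0 h1 hτ hk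
  have hE₂ := hξ.measureReal_exists_sq_ge_le hσ hn hX (by omega) hp2
  set E₁ := {ω | ∃ A : Finset (Fin p), A.card ≤ τ ∧ 128 * σ ^ 2 * n * (5 * S₁.card) ≤
        ∑ j ∈ S₁ ∪ A, X.transpose.mulVec (fun i => ξ i ω) j ^ 2}
  set E₂ := {ω | ∃ j, 128 * σ ^ 2 * n * (4 * Real.log p) ≤
        X.transpose.mulVec (fun i => ξ i ω) j ^ 2}
  set W := ∑ i ∈ S₂, βs i ^ 2 with hW
  have hW0 : 0 ≤ W := Finset.sum_nonneg fun _ _ => sq_nonneg _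
  have hW' : ∑ i ∈ S₁ᶜ, βs i ^ 2 = W := by rw [hW, hS₁, hS₂, HTP.sum_compl_strong]
  set N := σ ^ 2 * (S₁.card / n) with hN
  have hN0 : 0 < N := by positivity
  set l := σ * Real.sqrt (Real.log p / n) with hl
  have hl0 : 0 ≤ l := by positivity
  have hl2 : l ^ 2 = σ ^ 2 * (Real.log p / n) := by
    rw [hl, mul_pow, Real.sq_sqrt (by positivity)]
  -- The iterates need not be measurable, so the bad set is compared with the noise events only
  -- through almost sure inclusion.
  have hsub : ∀ᵐ ω ∂μ, ω ∈ {ω | (C₀ ^ 2 + 3881) * (N + W) ≤ HTP.sqNorm (β t ω - βs)} →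
      ω ∈ E₁ ∪ E₂ := by
    filter_upwards [hinit, hstep] with ω hi hst hbad
    by_contra hgood
    rw [Set.mem_union, not_or] at hgood
    obtain ⟨hg₁, hg₂⟩ := hgood
    have hg₁' : ∀ A : Finset (Fin p), A.card ≤ τ →
        ∑ j ∈ S₁ ∪ A, (X.transpose.mulVec (fun i => ξ i ω) j / n) ^ 2 ≤ 640 * N := by
      intro A hA
      have : ∑ j ∈ S₁ ∪ A, X.transpose.mulVec (fun i => ξ i ω) j ^ 2
          < 128 * σ ^ 2 * n * (5 * S₁.card) := by
        by_contra! h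
        exact hg₁ ⟨A, hA, h⟩
      simp only [div_pow]
      rw [← Finset.sum_div, div_le_iff₀ (by positivity)]
      refine this.le.trans (le_of_eq ?_)
      rw [hN]
      field_simp
      norm_num
    have hg₂' : ∀ j, |X.transpose.mulVec (fun i => ξ i ω) j / n| ≤ 23 * l := by
      intro j
      have : X.transpose.mulVec (fun i => ξ i ω) j ^ 2
          < 128 * σ ^ 2 * n * (4 * Real.log p) := by
        by_contra! h
        exact hg₂ ⟨j, h⟩
      refine abs_le_of_sq_le_sq ?_ (by positivity)
      rw [div_pow, div_le_iff₀ (by positivity), mul_pow, hl2]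
      refine this.le.trans ?_
      have h3 : 23 ^ 2 * (σ ^ 2 * (Real.log p / n)) * (n : ℝ) ^ 2
          = 529 * (σ ^ 2 * n * Real.log p) := by field_simp; norm_num
      rw [h3]
      have : 0 ≤ σ ^ 2 * n * Real.log p := by positivity
      linarith
    have hstrong : ∀ i ∈ S₁, 4 * (23 * l) ≤ |βs i| := by
      intro i hi'
      rw [hS₁] at hi'
      have := (Finset.mem_filter.1 hi').2
      refine le_trans ?_ this
      rw [mul_assoc, ← hl]
      nlinarith
    have hmain := (HTP.sqNorm_iterate_sub_le (β := fun t => β t ω) hn hcol hs hδ hX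
      (hS₁ ▸ HTP.strong_subset_supp _ _) hg₂' (by positivity) hstrong hg₁' hi.1
      (fun t => hy ω ▸ hst t) t).2
    rw [hW'] at hmain
    have hlogt : Real.log p ≤ Real.exp t := by
      rw [one_pow, one_mul] at ht
      exact (Real.log_le_iff_le_exp hlogp).1 ht
    have hexp0 := Real.exp_pos (-(t : ℝ))
    have hexp1 : Real.exp (-(t : ℝ)) ≤ 1 := Real.exp_le_one_iff.2 (by simp)
    have hexpl : Real.exp (-(t : ℝ)) * Real.log p ≤ 1 := by
      calc _ ≤ Real.exp (-(t : ℝ)) * Real.exp t := by gcongr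
        _ = 1 := by rw [← Real.exp_add]; simp
    -- `t ≥ log log p` makes `exp (-t)` cancel the `log p` of the starting rate.
    have hstart : Real.exp (-(t : ℝ)) * HTP.sqNorm (β 0 ω - βs) ≤ C₀ ^ 2 * (N + W) := by
      calc _ ≤ Real.exp (-(t : ℝ))
              * (C₀ ^ 2 * (σ ^ 2 * (S₁.card * Real.log p / n) + W)) := by gcongr; exact hi.2
        _ = C₀ ^ 2 * (N * (Real.exp (-(t : ℝ)) * Real.log p) + Real.exp (-(t : ℝ)) * W) := by
            rw [hN]; ring
        _ ≤ C₀ ^ 2 * (N * 1 + 1 * W) := by gcongr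
        _ = _ := by ring
    have hbad' : (C₀ ^ 2 + 3881) * (N + W) ≤ HTP.sqNorm (β t ω - βs) := hbad
    linarith
  calc _ ≤ μ.real (E₁ ∪ E₂) :=
        ENNReal.toReal_mono (measure_ne_top _ _) (measure_mono_ae hsub)
    _ ≤ μ.real E₁ + μ.real E₂ := measureReal_union_le _ _
    _ ≤ _ := by
        refine add_le_add hE₁ (hE₂.trans ?_)
        -- The `1/p` from the coordinate bound is at most `|S₁|/p` because `|S₁| ≥ 1`.
        gcongr
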